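/- Write $\mathbb{R}^2$ for the Euclidean plane. For a smooth curve $\Gamma\subset\mathbb{R}^2$ let $X(\Gamma)$ be the space of all finite complex-valued Borel measures $\mu$ on $\mathbb{R}^2$ that are supported on $\Gamma$ and absolutely continuous with respect to the arc length measure on $\Gamma$, and for $\mu\in X(\Gamma)$ put $$\hat\mu(\xi,\eta)=\int_{\Gamma} e^{-i\pi(x\xi+y\eta)}\,d\mu(x,y),\qquad (\xi,\eta)\in\mathbb{R}^2 .$$ For $\Lambda\subset\mathbb{R}^2$, the pair $(\Gamma,\Lambda)$ is called a Heisenberg uniqueness pair if every $\mu\in X(\Gamma)$ with $\hat\mu(\xi,\eta)=0$ for all $(\xi,\eta)\in\Lambda$ is the zero measure. **Theorem.** Let $\Gamma=\{(\cosh t,\sinh t): t\ge 0\}$ and $\Lambda=\{(\cosh s,-\sinh s): s\in\mathbb{R}\}$. Then $(\Gamma,\Lambda)$ is a Heisenberg uniqueness pair. -/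

import Mathlib

open MeasureTheory

namespace HeisenbergUniqueness

/-- The plane `ℝ²` with its Euclidean metric. -/
abbrev Plane : Type := EuclideanSpace ℝ (Fin 2)

/-- The arc length measure on `Γ ⊆ ℝ²`: one-dimensional Hausdorff measure restricted to `Γ`. -/
noncomputable def arcLength (Γ : Set Plane) : Measure Plane :=
  (Measure.hausdorffMeasure 1).restrict Γ

/-- `X(Γ)`: the (automatically finite) complex Borel measures on `ℝ²` that are carried by `Γ` and
absolutely continuous with respect to the arc length measure on `Γ`. -/
def X (Γ : Set Plane) : Set (ComplexMeasure Plane) :=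
  {μ | (∀ A : Set Plane, MeasurableSet A → Disjoint A Γ → μ A = 0) ∧
    ∀ A : Set Plane, MeasurableSet A → arcLength Γ A = 0 → μ A = 0}

/-- The Fourier transform `μ̂(ξ, η) = ∫ exp (-iπ(xξ + yη)) dμ(x, y)` of a complex measure. Here the
integral against a complex measure pairs integrand and measure by multiplication in `ℂ`; for
`μ ∈ X(Γ)` it makes no difference to integrate over `Γ` or over the plane. -/
noncomputable def fourierTransform (μ : ComplexMeasure Plane) (ζ : Plane) : ℂ :=
  VectorMeasure.integral μ
    (fun z : Plane ↦ Complex.exp (-(Complex.I * Real.pi * ((z 0 * ζ 0 + z 1 * ζ 1 : ℝ) : ℂ))))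
    (ContinuousLinearMap.mul ℝ ℂ)

/-- `(Γ, Λ)` is a Heisenberg uniqueness pair (for `X(Γ)`). -/
def IsHUP (Γ Λ : Set Plane) : Prop :=
  ∀ μ ∈ X Γ, (∀ ζ ∈ Λ, fourierTransform μ ζ = 0) → μ = 0

end HeisenbergUniqueness

/-!
Write `x = e^t` for a point `(cosh t, sinh t)` of `Γ`; then `x ≥ 1`, and `μ` becomes a complex
measure `ν` on `[1, ∞)`. Against the point of `Λ` with parameter `s`, the Fourier kernel is
`exp (-(iπ/2) (x e^{-s} + e^s / x))`, so the hypothesis says that the integral of this kernel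
against `ν` vanishes for every real `s`.

*Continuation.* Because `x ≥ 1`, the kernel is bounded on `0 ≤ Im s ≤ π` locally uniformly in `s`
and uniformly in `x`. The transform of `ν` is therefore holomorphic in the strip and continuous up
to its boundary; as it vanishes on the real line, it vanishes on `Im s = π / 2`
(`integral_exp_phase_eq_zero`). There the kernel is real, and the conclusion reads
`∫ e^{-p x + c / (p x)} dν(x) = 0` for all `p > 0`, with `c = π² / 4`.

*Laplace inversion.* After division by `p`, the kernel is the Laplace transform in `y` of
`1_{x < y} I₀(2 √(c (y - x) / x))`. By uniqueness of the Laplace transform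
(`ae_eq_zero_of_integral_exp_neg_pow_mul_eq_zero`) the integral of this function of `x` against
`ν` vanishes for almost every `y`.

*Volterra equation.* Integrating by parts, this is an equation `H(y) + ∫_1^y k(y, t) H(t) dt = 0`
for the distribution function `H(t) = ν([1, t))`, with a kernel `k` bounded on compact sets. Hence
`H = 0` (`ae_eq_zero_of_abs_le_mul_integral`) and `ν = 0` (`setIntegral_preimage_eq_zero`).

The measure `ν` is not formed: `μ` is written as `h · m` with `m` finite and `h` integrable, and `x`
is a measurable function `X` on the plane.
-/

namespace HeisenbergUniqueness

/-! ### Analytic continuation to the middle of the strip -/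

section Continuation

open Complex Set
open scoped Real

/-- A holomorphic function on a square that vanishes on one side vanishes at the centre: the product
of its four rotations about the centre vanishes on the whole boundary, so the maximum principle
applies. This replaces the Schwarz reflection principle. -/
theorem eq_zero_of_square_side {f : ℂ → ℂ} {r : ℝ} (hr : 0 < r)
    (hf : DiffContOnCl ℂ f (Ioo (-r) r ×ℂ Ioo (-r) r))
    (h0 : ∀ z : ℂ, z.im = -r → |z.re| ≤ r → f z = 0) : f 0 = 0 := by
  set Q : Set ℂ := Ioo (-r) r ×ℂ Ioo (-r) r with hQ
  have hrot : ∀ u : ℂ, MapsTo (fun z => u * z) Q Q →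
      DiffContOnCl ℂ (fun z => f (u * z)) Q := fun u hu =>
    hf.comp (Differentiable.diffContOnCl (by fun_prop)) hu
  have m1 : MapsTo (fun z => (-1 : ℂ) * z) Q Q := by
    intro z hz
    simp only [hQ, mem_reProdIm, mem_Ioo] at hz ⊢
    simp; constructor <;> constructor <;> linarith [hz.1.1, hz.1.2, hz.2.1, hz.2.2]
  have m2 : MapsTo (fun z => I * z) Q Q := by
    intro z hz
    simp only [hQ, mem_reProdIm, mem_Ioo] at hz ⊢
    simp; refine ⟨⟨?_, ?_⟩, ?_, ?_⟩ <;> linarith [hz.1.1, hz.1.2, hz.2.1, hz.2.2]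
  have m3 : MapsTo (fun z => (-I) * z) Q Q := by
    intro z hz
    simp only [hQ, mem_reProdIm, mem_Ioo] at hz ⊢
    simp; refine ⟨⟨?_, ?_⟩, ?_, ?_⟩ <;> linarith [hz.1.1, hz.1.2, hz.2.1, hz.2.2]
  have hmul : ∀ {f g : ℂ → ℂ}, DiffContOnCl ℂ f Q → DiffContOnCl ℂ g Q →
      DiffContOnCl ℂ (fun z => f z * g z) Q := fun hf hg =>
    ⟨hf.1.mul hg.1, hf.2.mul hg.2⟩
  set P : ℂ → ℂ := fun z => (f z * f (-1 * z)) * (f (I * z) * f (-I * z)) with hP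
  have hPd : DiffContOnCl ℂ P Q := hmul (hmul hf (hrot _ m1)) (hmul (hrot _ m2) (hrot _ m3))
  have hbd : Bornology.IsBounded Q :=
    (Metric.isBounded_Ioo _ _).reProdIm (Metric.isBounded_Ioo _ _)
  have hfr : ∀ z ∈ frontier Q, ‖P z‖ ≤ 0 := by
    intro z hz
    rw [hQ, Complex.frontier_reProdIm, closure_Ioo (by linarith), frontier_Ioo (by linarith)] at hz
    simp only [mem_union, mem_reProdIm, mem_Icc, mem_insert_iff, mem_singleton_iff] at hz
    rw [norm_le_zero_iff]
    rcases hz with ⟨hre, him | him⟩ | ⟨hre | hre, him⟩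
    · have : f z = 0 := h0 _ him (abs_le.2 hre)
      simp [hP, this]
    · have : f (-1 * z) = 0 := h0 _ (by simp [him]) (by simpa [abs_le, and_comm, neg_le] using hre)
      simp only [hP, this]; simp
    · have : f (I * z) = 0 := h0 _ (by simp [hre]) (by simpa [abs_le, and_comm, neg_le] using him)
      simp only [hP, this]; simp
    · have : f (-I * z) = 0 := h0 _ (by simp [hre]) (by simpa [abs_le] using him)
      simp only [hP, this]; simp
  have h0Q : (0 : ℂ) ∈ closure Q := subset_closure (by simp [hQ, mem_reProdIm, hr])
  have := Complex.norm_le_of_forall_mem_frontier_norm_le hbd hPd hfr h0Q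
  rw [norm_le_zero_iff] at this
  simpa [hP] using this

/-- An integral of holomorphic functions with a common integrable bound is holomorphic. No bound on
the derivative is assumed; Cauchy's estimate supplies one on smaller discs. -/
theorem differentiableOn_integral {Ω : Type*} [MeasurableSpace Ω] {m : Measure Ω} {U : Set ℂ}
    (hU : IsOpen U) {F F' : ℂ → Ω → ℂ} {g : Ω → ℝ} (hg : Integrable g m)
    (hF : ∀ z ∈ U, AEStronglyMeasurable (F z) m)
    (hF' : ∀ z ∈ U, AEStronglyMeasurable (F' z) m)
    (hd : ∀ ω, ∀ z ∈ U, HasDerivAt (fun z => F z ω) (F' z ω) z)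
    (hb : ∀ z ∈ U, ∀ ω, ‖F z ω‖ ≤ g ω) :
    DifferentiableOn ℂ (fun z => ∫ ω, F z ω ∂m) U := by
  intro z hz
  obtain ⟨ε, hε, hball⟩ := Metric.isOpen_iff.1 hU z hz
  have hsub : ∀ w ∈ Metric.ball z (ε / 2), Metric.closedBall w (ε / 4) ⊆ U := by
    intro w hw v hv
    apply hball
    rw [Metric.mem_ball] at hw ⊢
    rw [Metric.mem_closedBall] at hv
    linarith [dist_triangle v w z]
  have key := hasDerivAt_integral_of_dominated_loc_of_deriv_le (μ := m) (F := F) (F' := F')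
    (x₀ := z) (bound := fun ω => g ω / (ε / 4)) (s := Metric.ball z (ε / 2))
    (Metric.ball_mem_nhds z (by linarith)) ?_ ?_ (hF' z hz) ?_ (hg.div_const _) ?_
  · exact key.2.differentiableAt.differentiableWithinAt
  · filter_upwards [hU.mem_nhds hz] with w hw using hF w hw
  · exact hg.mono' (hF z hz) (Filter.Eventually.of_forall (hb z hz))
  · refine Filter.Eventually.of_forall fun ω w hw => ?_
    have hw' : w ∈ U := hsub w hw (Metric.mem_closedBall_self (by linarith))
    rw [← (hd ω w hw').deriv]
    refine Complex.norm_deriv_le_of_forall_mem_sphere_norm_le (by linarith) ?_ ?_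
    · refine DifferentiableOn.diffContOnCl fun v hv => ?_
      rw [closure_ball _ (by linarith)] at hv
      exact (hd ω v (hsub w hw hv)).differentiableAt.differentiableWithinAt
    · exact fun v hv => hb v (hsub w hw (Metric.sphere_subset_closedBall hv)) ω
  · exact Filter.Eventually.of_forall fun ω w hw =>
      hd ω w (hsub w hw (Metric.mem_closedBall_self (by linarith)))

/-- The exponent `-(iπ/2) (x e^{-z} + e^z / x)`. For `x = e^t` and `z = s` real it equals
`-iπ (cosh t cosh s - sinh t sinh s)`, the exponent of the Fourier kernel between the point of
`Γ` with parameter `t` and the point of `Λ` with parameter `s`. -/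
noncomputable def phase (z : ℂ) (x : ℝ) : ℂ :=
  -(I * π / 2) * (x * exp (-z) + exp z / x)

/-- On the strip `0 ≤ Im z ≤ π` the kernel is bounded uniformly in `x ≥ 1`. This is where the
restriction to the half-branch `t ≥ 0` enters: the growing factor `exp (π sin (Im z) e^{Re z} / 2x)`
stays bounded as long as `x` does not approach `0`. -/
theorem norm_exp_phase_le {z : ℂ} {x : ℝ} (hx : 1 ≤ x) (h0 : 0 ≤ z.im) (hπ : z.im ≤ π) :
    ‖exp (phase z x)‖ ≤ Real.exp (π / 2 * Real.exp z.re) := by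
  rw [Complex.norm_exp]
  apply Real.exp_le_exp.2
  have hre : (phase z x).re = π / 2 * (Real.sin z.im * (Real.exp z.re / x) -
      Real.sin z.im * (x * Real.exp (-z.re))) := by
    rw [phase, div_eq_mul_inv (exp z) (x : ℂ), ← Complex.ofReal_inv]
    simp [Complex.exp_re, Complex.exp_im]
    ring
  rw [hre]
  have hs := Real.sin_nonneg_of_nonneg_of_le_pi h0 hπ
  have hs1 := Real.sin_le_one z.im
  have h1 : Real.exp z.re / x ≤ Real.exp z.re := div_le_self (Real.exp_pos _).le hx
  have h2 : 0 ≤ Real.sin z.im * (x * Real.exp (-z.re)) := by positivity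
  have h3 : Real.sin z.im * (Real.exp z.re / x) ≤ 1 * Real.exp z.re := by
    gcongr
  have := Real.pi_pos
  gcongr
  linarith

theorem hasDerivAt_exp_phase (x : ℝ) (z : ℂ) : HasDerivAt (fun z => exp (phase z x))
    (exp (phase z x) * (-(I * π / 2) * (x * (exp (-z) * -1) + exp z / x))) z := by
  unfold phase
  exact ((((hasDerivAt_neg z).cexp.const_mul (x : ℂ)).add
    ((Complex.hasDerivAt_exp z).div_const (x : ℂ))).const_mul _).cexp

theorem measurable_exp_phase (z : ℂ) : Measurable fun x : ℝ => exp (phase z x) := by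
  unfold phase
  fun_prop

/-- If the transform vanishes on the real line, it vanishes on the middle line `Im z = π / 2` of the
strip. -/
theorem integral_exp_phase_eq_zero {Ω : Type*} [MeasurableSpace Ω] {m : Measure Ω} {h : Ω → ℂ}
    {X : Ω → ℝ} (hh : Integrable h m) (hX : Measurable X) (hX1 : ∀ ω, 1 ≤ X ω)
    (h0 : ∀ s : ℝ, ∫ ω, h ω * exp (phase s (X ω)) ∂m = 0) (s : ℝ) :
    ∫ ω, h ω * exp (phase (s + π / 2 * I) (X ω)) ∂m = 0 := by
  have hπ := Real.pi_pos
  -- The square centred at `c` with half-side `π / 2` spans the strip; its lower side is real.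
  set c : ℂ := s + π / 2 * I with hc
  set C : ℝ := Real.exp (π / 2 * Real.exp (s + π / 2)) with hC
  set F : ℂ → Ω → ℂ := fun z ω => h ω * exp (phase (c + z) (X ω)) with hF
  have hFm : ∀ z, AEStronglyMeasurable (F z) m := fun z =>
    hh.aestronglyMeasurable.mul ((measurable_exp_phase _).comp hX).aestronglyMeasurable
  set K : Set ℂ := Icc (-(π / 2)) (π / 2) ×ℂ Icc (-(π / 2)) (π / 2) with hK
  have hbound : ∀ z ∈ K, ∀ ω, ‖F z ω‖ ≤ ‖h ω‖ * C := by
    intro z hz ω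
    simp only [hK, mem_reProdIm, mem_Icc] at hz
    rw [hF, norm_mul]
    gcongr
    refine (norm_exp_phase_le (hX1 ω) ?_ ?_).trans ?_
    · simp [hc]; linarith
    · simp [hc]; linarith
    · rw [hC]
      gcongr
      simp [hc]; linarith
  have hgi : Integrable (fun ω => ‖h ω‖ * C) m := hh.norm.mul_const C
  have hQK : Ioo (-(π / 2)) (π / 2) ×ℂ Ioo (-(π / 2)) (π / 2) ⊆ K := fun z hz =>
    ⟨Ioo_subset_Icc_self hz.1, Ioo_subset_Icc_self hz.2⟩
  have hd : ∀ ω z, HasDerivAt (fun z => F z ω) (h ω * (exp (phase (c + z) (X ω)) *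
      (-(I * π / 2) * (X ω * (exp (-(c + z)) * -1) + exp (c + z) / X ω)))) z := fun ω z =>
    ((hasDerivAt_exp_phase (X ω) (c + z)).comp_const_add c z).const_mul (h ω)
  have hcl : DiffContOnCl ℂ (fun z => ∫ ω, F z ω ∂m)
      (Ioo (-(π / 2)) (π / 2) ×ℂ Ioo (-(π / 2)) (π / 2)) := by
    constructor
    · refine differentiableOn_integral (isOpen_Ioo.reProdIm isOpen_Ioo) hgi (fun z _ => hFm z) ?_
        (fun ω z _ => hd ω z) (fun z hz => hbound z (hQK hz))
      intro z _
      refine hh.aestronglyMeasurable.mul (Measurable.aestronglyMeasurable ?_)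
      refine ((measurable_exp_phase _).comp hX).mul ?_
      fun_prop
    · rw [closure_reProdIm, closure_Ioo (by linarith)]
      exact continuousOn_of_dominated (fun z _ => hFm z)
        (fun z hz => Filter.Eventually.of_forall (hbound z hz)) hgi
        (Filter.Eventually.of_forall fun ω z _ => (hd ω z).continuousAt.continuousWithinAt)
  have := eq_zero_of_square_side (half_pos hπ) hcl ?_
  · simpa [hF] using this
  · intro z him _
    have hz : c + z = ((s + z.re : ℝ) : ℂ) := by
      apply Complex.ext <;> simp [hc, him]
    simp only [hF, hz]
    exact h0 _

end Continuation

/-! ### Uniqueness of the Laplace transform -/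

section LaplaceUniqueness

open Set Filter

theorem integral_polynomial_exp_neg_mul_eq_zero {g : ℝ → ℝ} (hg : IntegrableOn g (Ioi 0))
    (h : ∀ n : ℕ, ∫ y in Ioi (0 : ℝ), Real.exp (-y) ^ n * g y = 0) (q : Polynomial ℝ) :
    ∫ y in Ioi (0 : ℝ), q.eval (Real.exp (-y)) * g y = 0 := by
  have hint : ∀ n : ℕ, IntegrableOn (fun y => q.coeff n * (Real.exp (-y) ^ n * g y)) (Ioi 0) := by
    intro n
    refine (Integrable.mono' hg.norm ?_ ?_).const_mul _
    · exact (Continuous.aestronglyMeasurable (by fun_prop)).mul hg.aestronglyMeasurable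
    · refine (ae_restrict_iff' measurableSet_Ioi).2 (Eventually.of_forall fun y hy => ?_)
      rw [norm_mul, norm_pow, Real.norm_of_nonneg (Real.exp_pos _).le]
      exact mul_le_of_le_one_left (norm_nonneg _)
        (pow_le_one₀ (Real.exp_pos _).le (Real.exp_le_one_iff.2 (by simpa using hy.le)))
  simp_rw [Polynomial.eval_eq_sum_range, Finset.sum_mul, mul_assoc]
  rw [integral_finsetSum _ fun n _ => hint n]
  refine Finset.sum_eq_zero fun n _ => ?_
  rw [integral_const_mul, h n, mul_zero]

/-- Uniqueness for the Laplace transform sampled at the natural numbers: in the variable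
`u = exp (-y) ∈ (0, 1)` the hypothesis says that all moments vanish, and polynomials are dense in
the continuous functions on `[0, 1]`. -/
theorem ae_eq_zero_of_integral_exp_neg_pow_mul_eq_zero {g : ℝ → ℝ} (hg : IntegrableOn g (Ioi 0))
    (h : ∀ n : ℕ, ∫ y in Ioi (0 : ℝ), Real.exp (-y) ^ n * g y = 0) :
    ∀ᵐ y, 0 < y → g y = 0 := by
  refine isOpen_Ioi.ae_eq_zero_of_integral_contDiff_smul_eq_zero hg.locallyIntegrableOn ?_
  intro t ht htc hts
  rw [← setIntegral_eq_integral_of_forall_compl_eq_zero (s := Ioi (0 : ℝ)) (fun y hy => by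
    rw [image_eq_zero_of_notMem_tsupport (fun h' => hy (hts h')), zero_smul])]
  have ht0 : ∀ y, y ≤ 0 → t y = 0 := fun y hy =>
    image_eq_zero_of_notMem_tsupport fun h' => absurd (hts h') (not_lt.2 hy)
  -- The test function in the variable `u = exp (-y)`. The junk value `log 0 = 0` is harmless at
  -- `u = 0`, since `t` vanishes both at `0` and for large arguments.
  set φ : ℝ → ℝ := fun u => t (-Real.log u) with hφ
  have hφc : ContinuousOn φ (Icc 0 1) := by
    intro u hu
    rcases hu.1.eq_or_lt with rfl | hu0
    · have hev : ∀ᶠ u in nhdsWithin (0 : ℝ) (Icc 0 1), φ u = 0 := by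
        obtain ⟨R, hR⟩ := htc.isBounded.subset_closedBall 0
        filter_upwards [mem_nhdsWithin_of_mem_nhds (Iio_mem_nhds (Real.exp_pos (-R))),
          self_mem_nhdsWithin] with u huR hu
        rcases hu.1.eq_or_lt with rfl | hu0
        · simp [hφ, ht0]
        · refine image_eq_zero_of_notMem_tsupport (f := t) fun h' => ?_
          have h1 := hR h'
          rw [mem_closedBall_zero_iff, Real.norm_eq_abs] at h1
          have h2 : Real.log u < -R := (Real.log_lt_iff_lt_exp hu0).2 huR
          linarith [le_abs_self (-Real.log u)]
      refine (tendsto_const_nhds.congr' ?_ : Tendsto φ _ _)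
      filter_upwards [hev] with v hv
      rw [hv]; simp [hφ, ht0]
    · exact (ht.continuous.continuousAt.comp
        (Real.continuousAt_log hu0.ne').neg).continuousWithinAt
  have heq : ∀ y, t y = φ (Real.exp (-y)) := fun y => by simp [hφ]
  simp_rw [heq, smul_eq_mul]
  set N : ℝ := ∫ y in Ioi (0 : ℝ), ‖g y‖ with hN
  have hN0 : 0 ≤ N := integral_nonneg fun _ => norm_nonneg _
  rw [← norm_le_zero_iff]
  refine le_of_forall_pos_le_add fun ε hε => ?_
  obtain ⟨q, hq⟩ := exists_polynomial_near_of_continuousOn 0 1 φ hφc (ε / (N + 1)) (by positivity)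
  have hexp : ∀ y ∈ Ioi (0 : ℝ), Real.exp (-y) ∈ Icc (0 : ℝ) 1 := fun y hy =>
    ⟨(Real.exp_pos _).le, Real.exp_le_one_iff.2 (by simpa using hy.le)⟩
  have hbd : ∀ y ∈ Ioi (0 : ℝ),
      ‖(q.eval (Real.exp (-y)) - φ (Real.exp (-y))) * g y‖ ≤ ε / (N + 1) * ‖g y‖ := fun y hy => by
    rw [norm_mul]
    gcongr
    exact (hq _ (hexp y hy)).le
  have hmeas : AEStronglyMeasurable (fun y => φ (Real.exp (-y))) (volume.restrict (Ioi 0)) := by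
    simp_rw [← heq]; exact ht.continuous.aestronglyMeasurable
  have hdi : IntegrableOn
      (fun y => (q.eval (Real.exp (-y)) - φ (Real.exp (-y))) * g y) (Ioi 0) := by
    refine Integrable.mono' (hg.norm.const_mul (ε / (N + 1))) ?_
      ((ae_restrict_iff' measurableSet_Ioi).2 (Eventually.of_forall hbd))
    exact ((Continuous.aestronglyMeasurable (by fun_prop)).sub hmeas).mul hg.aestronglyMeasurable
  have hti : IntegrableOn (fun y => φ (Real.exp (-y)) * g y) (Ioi 0) := by
    simp_rw [← heq]
    obtain ⟨C, hC⟩ := htc.exists_bound_of_continuous ht.continuous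
    exact hg.bdd_mul ht.continuous.aestronglyMeasurable (Eventually.of_forall hC)
  have hq0 := integral_polynomial_exp_neg_mul_eq_zero hg h q
  have hsplit : ∫ y in Ioi (0 : ℝ), φ (Real.exp (-y)) * g y =
      -∫ y in Ioi (0 : ℝ), (q.eval (Real.exp (-y)) - φ (Real.exp (-y))) * g y := by
    rw [← sub_eq_zero, sub_neg_eq_add, ← integral_add hti hdi]
    refine Eq.trans ?_ hq0
    congr 1; ext y; ring
  rw [hsplit, norm_neg, zero_add]
  calc _ ≤ ∫ y in Ioi (0 : ℝ), ε / (N + 1) * ‖g y‖ :=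
        norm_integral_le_of_norm_le (hg.norm.const_mul _)
          ((ae_restrict_iff' measurableSet_Ioi).2 (Eventually.of_forall hbd))
    _ = ε * (N / (N + 1)) := by rw [integral_const_mul]; ring
    _ ≤ ε := mul_le_of_le_one_right hε.le ((div_le_one (by positivity)).2 (by linarith))

end LaplaceUniqueness

/-! ### The series of the modified Bessel function -/

section BesselSeries

open Set Filter
open scoped Nat

/-- The entire function `∑ z ^ k / (k!)²`, equal to the modified Bessel function `I₀(2 √z)` for
`z ≥ 0`. -/
noncomputable def besselSeries (z : ℝ) : ℝ := ∑' k : ℕ, z ^ k / (k ! : ℝ) ^ 2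

theorem contDiff_besselSeries : ContDiff ℝ 1 besselSeries := by
  set c : ℕ → ℝ := fun k => ((k ! : ℝ) ^ 2)⁻¹ with hc
  have hrad : (FormalMultilinearSeries.ofScalars ℝ c).radius = ⊤ := by
    apply FormalMultilinearSeries.ofScalars_radius_eq_top_of_tendsto
    · exact Eventually.of_forall fun n => by positivity
    · have : (fun n : ℕ => ‖c n.succ‖ / ‖c n‖) = fun n : ℕ => (1 / ((n : ℝ) + 1)) ^ 2 := by
        ext n
        have : (n ! : ℝ) ≠ 0 := by positivity
        simp only [hc, Nat.succ_eq_add_one, Nat.factorial_succ, Nat.cast_mul, norm_inv, norm_pow,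
          norm_mul, Real.norm_natCast]
        push_cast
        field_simp
      rw [this]
      simpa using (tendsto_one_div_add_atTop_nhds_zero_nat (𝕜 := ℝ)).pow 2
  have hsum : besselSeries = (FormalMultilinearSeries.ofScalars ℝ c).sum := by
    ext z
    change _ = FormalMultilinearSeries.ofScalarsSum c z
    rw [FormalMultilinearSeries.ofScalars_sum_eq, besselSeries]
    congr 1; ext k; simp [hc]; ring
  have han := ((FormalMultilinearSeries.ofScalars ℝ c).hasFPowerSeriesOnBall
    (by rw [hrad]; exact ENNReal.zero_lt_top)).analyticOnNhd
  rw [hrad, Metric.eball_top, ← hsum] at han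
  exact contDiffOn_univ.1 (han.contDiffOn uniqueDiffOn_univ)

theorem besselSeries_zero : besselSeries 0 = 1 := by
  rw [besselSeries, tsum_eq_single 0 (fun k hk => by simp [hk])]
  simp

theorem besselSeries_term_le {z : ℝ} (hz : 0 ≤ z) (k : ℕ) :
    z ^ k / (k ! : ℝ) ^ 2 ≤ z ^ k / (k ! : ℝ) := by
  have : (1 : ℝ) ≤ k ! := by exact_mod_cast Nat.succ_le_of_lt (Nat.factorial_pos k)
  gcongr
  nlinarith

theorem besselSeries_nonneg {z : ℝ} (hz : 0 ≤ z) : 0 ≤ besselSeries z :=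
  tsum_nonneg fun k => by positivity

theorem summable_besselSeries {z : ℝ} (hz : 0 ≤ z) :
    Summable fun k : ℕ => z ^ k / (k ! : ℝ) ^ 2 :=
  (Real.summable_pow_div_factorial z).of_nonneg_of_le (fun k => by positivity)
    (besselSeries_term_le hz)

theorem besselSeries_le_exp {z : ℝ} (hz : 0 ≤ z) : besselSeries z ≤ Real.exp z := by
  rw [Real.exp_eq_exp_ℝ, NormedSpace.exp_eq_tsum_div]
  exact (summable_besselSeries hz).tsum_le_tsum (besselSeries_term_le hz)
    (Real.summable_pow_div_factorial z)

/-- The Laplace transform of `u ↦ besselSeries (a u)` is `e^{a / p} / p`, computed term by term. -/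
theorem integral_exp_neg_mul_besselSeries {a p : ℝ} (ha : 0 < a) (hp : 0 < p) :
    ∫ u in Ioi (0 : ℝ), Real.exp (-(p * u)) * besselSeries (a * u) = Real.exp (a / p) / p := by
  have hterm : ∀ k : ℕ, ∫ u in Ioi (0 : ℝ),
      Real.exp (-(p * u)) * ((a * u) ^ k / (k ! : ℝ) ^ 2) = (a / p) ^ k / k ! / p := by
    intro k
    have h1 := Real.integral_rpow_mul_exp_neg_mul_Ioi (a := (k : ℝ) + 1) (by positivity) hp
    rw [add_sub_cancel_right, Real.Gamma_nat_eq_factorial] at h1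
    simp_rw [Real.rpow_natCast] at h1
    have h2 : (fun u : ℝ => Real.exp (-(p * u)) * ((a * u) ^ k / (k ! : ℝ) ^ 2)) =
        fun u => (a ^ k / (k ! : ℝ) ^ 2) * (u ^ k * Real.exp (-(p * u))) := by
      ext u; rw [mul_pow]; ring
    rw [h2, integral_const_mul, h1]
    have : (k ! : ℝ) ≠ 0 := by positivity
    have h3 : (1 / p) ^ ((k : ℝ) + 1) = (1 / p) ^ (k + 1) := by
      rw [← Real.rpow_natCast]; norm_cast
    rw [h3, div_pow, div_pow, one_pow]
    field_simp
    ring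
  have hint : ∀ k : ℕ, IntegrableOn
      (fun u : ℝ => Real.exp (-(p * u)) * ((a * u) ^ k / (k ! : ℝ) ^ 2)) (Ioi 0) := by
    intro k
    refine Integrable.of_integral_ne_zero ?_
    rw [hterm k]
    positivity
  have hnorm : ∀ k : ℕ, ∫ u in Ioi (0 : ℝ),
      ‖Real.exp (-(p * u)) * ((a * u) ^ k / (k ! : ℝ) ^ 2)‖ = (a / p) ^ k / k ! / p := by
    intro k
    rw [← hterm k]
    refine setIntegral_congr_fun measurableSet_Ioi fun u hu => ?_
    have : (0 : ℝ) < u := hu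
    exact Real.norm_of_nonneg (by positivity)
  have hs := hasSum_integral_of_summable_integral_norm hint
    (by simp_rw [hnorm]; exact (Real.summable_pow_div_factorial _).div_const p)
  simp_rw [hterm, tsum_mul_left] at hs
  have hs' : HasSum (fun k : ℕ => (a / p) ^ k / k ! / p) (Real.exp (a / p) / p) := by
    rw [Real.exp_eq_exp_ℝ]
    exact (NormedSpace.expSeries_div_hasSum_exp (a / p)).div_const p
  exact hs.unique hs'

end BesselSeries

/-! ### Laplace inversion and the Volterra kernel -/

section Kernels

open Set Filter

/-- The inverse Laplace transform, in the variable `y`, of `p ↦ e^{-p x + c / (p x)} / p`; see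
`integral_exp_neg_mul_besselKernel`. -/
noncomputable def besselKernel (c x y : ℝ) : ℝ :=
  if x < y then besselSeries (c / x * (y - x)) else 0

section kernel
variable {c x y : ℝ}

theorem besselKernel_nonneg (hc : 0 < c) (hx : 1 ≤ x) : 0 ≤ besselKernel c x y := by
  unfold besselKernel
  split_ifs with h
  · have := sub_pos.2 h
    exact besselSeries_nonneg (by positivity)
  · exact le_rfl

theorem besselKernel_le_exp (hc : 0 < c) (hx : 1 ≤ x) :
    besselKernel c x y ≤ Real.exp (c * y) := by
  unfold besselKernel
  split_ifs with h
  · have h0 := sub_pos.2 h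
    refine (besselSeries_le_exp (by positivity)).trans (Real.exp_le_exp.2 ?_)
    have h1 : c / x ≤ c := div_le_self hc.le hx
    gcongr
    linarith
  · positivity

theorem measurable_besselKernel (c : ℝ) :
    Measurable fun q : ℝ × ℝ => besselKernel c q.1 q.2 := by
  refine Measurable.ite (measurableSet_lt measurable_fst measurable_snd) ?_ measurable_const
  exact contDiff_besselSeries.continuous.measurable.comp (by fun_prop)

theorem integral_exp_neg_mul_besselKernel (hc : 0 < c) (hx : 1 ≤ x) {p : ℝ} (hp : 0 < p) :
    ∫ y in Ioi (0 : ℝ), Real.exp (-(p * y)) * besselKernel c x y =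
      Real.exp (-(p * x) + c / (p * x)) / p := by
  have h1 : ∫ y in Ioi (0 : ℝ), Real.exp (-(p * y)) * besselKernel c x y =
      ∫ y, (Ioi (0 : ℝ)).indicator
        (fun u => Real.exp (-(p * (u + x))) * besselSeries (c / x * u)) (y - x) := by
    rw [← integral_indicator measurableSet_Ioi]
    congr 1; ext y
    by_cases h : x < y
    · have h0 : 0 < y := by linarith
      simp [indicator, besselKernel, h, h0]
    · simp [indicator, besselKernel, h]
  rw [h1, integral_sub_right_eq_self, integral_indicator measurableSet_Ioi]
  have h2 : (fun u => Real.exp (-(p * (u + x))) * besselSeries (c / x * u)) =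
      fun u => Real.exp (-(p * x)) * (Real.exp (-(p * u)) * besselSeries (c / x * u)) := by
    ext u
    rw [← mul_assoc, ← Real.exp_add]; ring_nf
  rw [h2, integral_const_mul, integral_exp_neg_mul_besselSeries (by positivity) hp, Real.exp_add,
    mul_div_assoc, div_div, mul_comm x p]

end kernel

section transform
variable {Ω : Type*} [MeasurableSpace Ω] {m : Measure Ω} {h : Ω → ℝ} {X : Ω → ℝ} {c : ℝ}

theorem integrable_exp_neg_mul_besselKernel [SFinite m] (hh : Integrable h m) (hX : Measurable X)
    (hX1 : ∀ ω, 1 ≤ X ω) (hc : 0 < c) {p : ℝ} (hp : c < p) :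
    Integrable (fun q : ℝ × Ω => Real.exp (-(p * q.1)) * (h q.2 * besselKernel c (X q.2) q.1))
      ((volume.restrict (Ioi 0)).prod m) := by
  have hdom : Integrable (fun q : ℝ × Ω => Real.exp (-(p - c) * q.1) * ‖h q.2‖)
      ((volume.restrict (Ioi 0)).prod m) :=
    Integrable.mul_prod (exp_neg_integrableOn_Ioi 0 (sub_pos.2 hp)) hh.norm
  refine hdom.mono' ?_ (Eventually.of_forall fun q => ?_)
  · refine AEStronglyMeasurable.mul (Measurable.aestronglyMeasurable (by fun_prop))
      (hh.aestronglyMeasurable.comp_snd.mul (Measurable.aestronglyMeasurable ?_))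
    exact (measurable_besselKernel c).comp ((hX.comp measurable_snd).prodMk measurable_fst)
  · rw [norm_mul, norm_mul, Real.norm_of_nonneg (Real.exp_pos _).le,
      Real.norm_of_nonneg (besselKernel_nonneg hc (hX1 _))]
    calc _ ≤ Real.exp (-(p * q.1)) * (‖h q.2‖ * Real.exp (c * q.1)) := by
          gcongr
          exact besselKernel_le_exp hc (hX1 _)
      _ = Real.exp (-(p * q.1)) * Real.exp (c * q.1) * ‖h q.2‖ := by ring
      _ = _ := by rw [← Real.exp_add]; ring_nf

/-- Inverting the Laplace transform in `p` turns the vanishing of `∫ h e^{-pX + c/(pX)}` for all `p`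
into an identity at almost every `y`. -/
theorem ae_integral_besselKernel_eq_zero [SFinite m] (hh : Integrable h m) (hX : Measurable X)
    (hX1 : ∀ ω, 1 ≤ X ω) (hc : 0 < c)
    (h0 : ∀ p : ℝ, 0 < p → ∫ ω, h ω * Real.exp (-(p * X ω) + c / (p * X ω)) ∂m = 0) :
    ∀ᵐ y, 0 < y → ∫ ω, h ω * besselKernel c (X ω) y ∂m = 0 := by
  -- The kernel is bounded by `e^{c y}`, so `p > c` makes Fubini applicable.
  have hlap : ∀ p : ℝ, c < p →
      ∫ y in Ioi (0 : ℝ), Real.exp (-(p * y)) * ∫ ω, h ω * besselKernel c (X ω) y ∂m = 0 := by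
    intro p hp
    have hp0 : 0 < p := hc.trans hp
    simp_rw [← integral_const_mul]
    rw [integral_integral_swap (integrable_exp_neg_mul_besselKernel hh hX hX1 hc hp)]
    have : ∀ ω, ∫ y in Ioi (0 : ℝ), Real.exp (-(p * y)) * (h ω * besselKernel c (X ω) y) =
        h ω * Real.exp (-(p * X ω) + c / (p * X ω)) / p := by
      intro ω
      rw [mul_div_assoc, ← integral_exp_neg_mul_besselKernel hc (hX1 ω) hp0, ← integral_const_mul]
      congr 1; ext y; ring
    simp_rw [this]
    rw [integral_div, h0 p hp0, zero_div]
  have hint : IntegrableOn (fun y => Real.exp (-((c + 1) * y)) *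
      ∫ ω, h ω * besselKernel c (X ω) y ∂m) (Ioi 0) := by
    have := (integrable_exp_neg_mul_besselKernel hh hX hX1 hc (lt_add_one c)).integral_prod_left
    simp only [integral_const_mul] at this
    exact this
  have := ae_eq_zero_of_integral_exp_neg_pow_mul_eq_zero hint fun n => by
    refine Eq.trans ?_ (hlap (c + 1 + n) (by have : (0 : ℝ) ≤ n := n.cast_nonneg; linarith))
    congr 1; ext y
    rw [← mul_assoc, ← Real.exp_nat_mul, ← Real.exp_add]
    ring_nf
  filter_upwards [this] with y hy hy0
  exact (mul_eq_zero.1 (hy hy0)).resolve_left (Real.exp_ne_zero _)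

end transform

/-- The derivative in `t` of `-besselSeries (c / t * (y - t))`. It is the kernel of the Volterra
equation satisfied by the distribution function `t ↦ ∫_{X < t} h`. -/
noncomputable def volterraKernel (c y t : ℝ) : ℝ :=
  c * y / t ^ 2 * deriv besselSeries (c / t * (y - t))

theorem continuousOn_volterraKernel (c : ℝ) :
    ContinuousOn (fun q : ℝ × ℝ => volterraKernel c q.1 q.2) {q | 1 ≤ q.2} := by
  have h0 : ∀ q ∈ {q : ℝ × ℝ | 1 ≤ q.2}, q.2 ≠ 0 := fun q hq => (zero_lt_one.trans_le hq).ne'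
  have hd : Continuous (deriv besselSeries) := contDiff_besselSeries.continuous_deriv le_rfl
  unfold volterraKernel
  refine ContinuousOn.mul (ContinuousOn.div (by fun_prop) (by fun_prop)
    fun q hq => pow_ne_zero 2 (h0 q hq)) (hd.comp_continuousOn ?_)
  exact (ContinuousOn.div (by fun_prop) (by fun_prop) h0).mul (by fun_prop)

theorem exists_bound_volterraKernel (c Y : ℝ) :
    ∃ M : ℝ, 0 < M ∧ ∀ y ∈ Icc 1 Y, ∀ t ∈ Icc 1 Y, |volterraKernel c y t| ≤ M := by
  obtain ⟨C, hC⟩ := (isCompact_Icc.prod isCompact_Icc :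
      IsCompact (Icc 1 Y ×ˢ Icc 1 Y)).exists_bound_of_continuousOn
        ((continuousOn_volterraKernel c).mono fun q hq => hq.2.1)
  exact ⟨max C 1, by positivity, fun y hy t ht => (hC (y, t) ⟨hy, ht⟩).trans (le_max_left _ _)⟩

theorem integrableOn_volterraKernel (c y : ℝ) :
    IntegrableOn (volterraKernel c y) (Ioc 1 y) := by
  have : ContinuousOn (volterraKernel c y) (Icc 1 y) :=
    (continuousOn_volterraKernel c).comp (f := fun t => (y, t)) (by fun_prop) fun t ht => ht.1
  exact this.integrableOn_Icc.mono_set Ioc_subset_Icc_self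

/-- Integration by parts: `besselKernel c x y` is the unit jump at `y = x` plus an integral of
`volterraKernel` against the indicator of `x < t`. -/
theorem besselKernel_eq_indicator_add_integral {c x y : ℝ} (hx : 1 ≤ x) :
    besselKernel c x y = (if x < y then 1 else 0) +
      ∫ t in Ioc 1 y, volterraKernel c y t * (if x < t then 1 else 0) := by
  have hind : ∀ t, volterraKernel c y t * (if x < t then 1 else 0) =
      (Ioi x).indicator (volterraKernel c y) t := fun t => by
    by_cases h : x < t <;> simp [h]
  simp_rw [hind]
  rw [setIntegral_indicator measurableSet_Ioi]
  -- The assumption `1 ≤ x` makes the lower limit `1` of integration immaterial.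
  have hset : Ioc 1 y ∩ Ioi x = Ioc x y := by
    ext t; simp only [mem_inter_iff, mem_Ioc, mem_Ioi]
    constructor
    · rintro ⟨⟨_, h⟩, h'⟩; exact ⟨h', h⟩
    · rintro ⟨h, h'⟩; exact ⟨⟨by linarith, h'⟩, h⟩
  rw [hset]
  by_cases h : x < y
  · have hder : ∀ t ∈ uIcc x y, HasDerivAt (fun t => -besselSeries (c / t * (y - t)))
        (volterraKernel c y t) t := by
      intro t ht
      rw [uIcc_of_le h.le] at ht
      have ht0 : t ≠ 0 := (by linarith [ht.1] : (0 : ℝ) < t).ne'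
      have h1 : HasDerivAt (fun t => c / t * (y - t)) (-(c * y / t ^ 2)) t := by
        have := ((hasDerivAt_inv ht0).const_mul c).mul ((hasDerivAt_id t).const_sub y)
        convert! this using 1
        simp; field_simp; ring
      have h2 := (contDiff_besselSeries.differentiable one_ne_zero
        (c / t * (y - t))).hasDerivAt.comp t h1
      convert! h2.neg using 1
      simp [volterraKernel]; ring
    have hi : IntervalIntegrable (volterraKernel c y) volume x y := by
      rw [intervalIntegrable_iff_integrableOn_Ioc_of_le h.le]
      exact (integrableOn_volterraKernel c y).mono_set (Ioc_subset_Ioc_left hx)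
    rw [← intervalIntegral.integral_of_le h.le,
      intervalIntegral.integral_eq_sub_of_hasDerivAt hder hi]
    simp [besselKernel, h, besselSeries_zero]
  · simp [besselKernel, h]

/-- A Gronwall lemma: a bounded solution of a homogeneous Volterra inequality vanishes. -/
theorem ae_eq_zero_of_abs_le_mul_integral {H : ℝ → ℝ} {B M a b : ℝ} (hM : 0 < M)
    (hB : ∀ y, |H y| ≤ B)
    (hH : ∀ᵐ y, y ∈ Ioc a b → |H y| ≤ M * ∫ t in Ioc a y, |H t|) :
    ∀ᵐ y, y ∈ Ioc a b → H y = 0 := by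
  have hB0 : 0 ≤ B := (abs_nonneg _).trans (hB a)
  -- In the norm with weight `exp (2 M y)` the Volterra operator has norm at most `1 / 2`.
  have key : ∀ n : ℕ, ∀ᵐ y, y ∈ Ioc a b →
      |H y| ≤ B * (1 / 2) ^ n * Real.exp (2 * M * (y - a)) := by
    intro n
    induction n with
    | zero =>
      refine Eventually.of_forall fun y hy => (hB y).trans ?_
      rw [pow_zero, mul_one]
      have := sub_pos.2 hy.1
      exact le_mul_of_one_le_right hB0 (Real.one_le_exp (by positivity))
    | succ n ih =>
      filter_upwards [hH] with y hy hyab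
      refine (hy hyab).trans ?_
      have hc : Continuous fun t => B * (1 / 2) ^ n * Real.exp (2 * M * (t - a)) := by fun_prop
      have h1 : ∫ t in Ioc a y, |H t| ≤
          ∫ t in Ioc a y, B * (1 / 2) ^ n * Real.exp (2 * M * (t - a)) := by
        refine integral_mono_of_nonneg (Eventually.of_forall fun t => abs_nonneg _)
          (hc.integrableOn_Ioc) ?_
        refine (ae_restrict_iff' measurableSet_Ioc).2 ?_
        filter_upwards [ih] with t ht hty
        exact ht ⟨hty.1, hty.2.trans hyab.2⟩
      have h2 : ∫ t in Ioc a y, B * (1 / 2) ^ n * Real.exp (2 * M * (t - a)) =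
          B * (1 / 2) ^ n * ((Real.exp (2 * M * (y - a)) - 1) / (2 * M)) := by
        have hder : ∀ t ∈ uIcc a y, HasDerivAt
            (fun t => B * (1 / 2) ^ n * (Real.exp (2 * M * (t - a)) / (2 * M)))
            (B * (1 / 2) ^ n * Real.exp (2 * M * (t - a))) t := by
          intro t _
          have := ((((hasDerivAt_id t).sub_const a).const_mul (2 * M)).exp.div_const
            (2 * M)).const_mul (B * (1 / 2) ^ n)
          convert! this using 1
          rw [id, mul_one, mul_div_assoc, div_self (by positivity), mul_one]
        rw [← intervalIntegral.integral_of_le hyab.1.le,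
          intervalIntegral.integral_eq_sub_of_hasDerivAt hder (hc.intervalIntegrable _ _)]
        simp; ring
      calc M * ∫ t in Ioc a y, |H t|
          ≤ M * (B * (1 / 2) ^ n * ((Real.exp (2 * M * (y - a)) - 1) / (2 * M))) := by
            rw [← h2]; gcongr
        _ ≤ M * (B * (1 / 2) ^ n * (Real.exp (2 * M * (y - a)) / (2 * M))) := by
            gcongr; linarith
        _ = _ := by field_simp; ring
  filter_upwards [ae_all_iff.2 key] with y hy hyab
  have hlim : Tendsto (fun n : ℕ => B * (1 / 2 : ℝ) ^ n * Real.exp (2 * M * (y - a))) atTop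
      (nhds (B * 0 * Real.exp (2 * M * (y - a)))) :=
    ((tendsto_pow_atTop_nhds_zero_of_lt_one (by norm_num) (by norm_num)).const_mul B).mul_const _
  have := ge_of_tendsto' hlim fun n => hy n hyab
  simpa using this

end Kernels

/-! ### Vanishing of the distribution function -/

section Distribution

open Set Filter

section distribution
variable {Ω : Type*} [MeasurableSpace Ω] {m : Measure Ω} {h : Ω → ℝ} {X : Ω → ℝ} {c : ℝ}

theorem integrable_volterraKernel_mul [SFinite m] (hh : Integrable h m) (hX : Measurable X)
    (y : ℝ) : Integrable (fun q : ℝ × Ω =>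
      volterraKernel c y q.1 * (h q.2 * (if X q.2 < q.1 then 1 else 0)))
      ((volume.restrict (Ioc 1 y)).prod m) := by
  have hdom := (integrableOn_volterraKernel c y).integrable.mul_prod hh
  have hm : Measurable fun q : ℝ × Ω => (if X q.2 < q.1 then (1 : ℝ) else 0) :=
    Measurable.ite (measurableSet_lt (hX.comp measurable_snd) measurable_fst)
      measurable_const measurable_const
  refine (hdom.mul_bdd (c := 1) hm.aestronglyMeasurable (Eventually.of_forall fun q => ?_)).congr
    (Eventually.of_forall fun q => mul_assoc _ _ _)
  split_ifs <;> simp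

/-- The left-hand side as the Volterra operator `1 + K` applied to the distribution function
`t ↦ ∫_{X < t} h`. -/
theorem integral_besselKernel_eq [SFinite m] (hh : Integrable h m) (hX : Measurable X)
    (hX1 : ∀ ω, 1 ≤ X ω) (y : ℝ) :
    ∫ ω, h ω * besselKernel c (X ω) y ∂m = (∫ ω, h ω * (if X ω < y then 1 else 0) ∂m) +
      ∫ t in Ioc 1 y, volterraKernel c y t * ∫ ω, h ω * (if X ω < t then 1 else 0) ∂m := by
  have hint := integrable_volterraKernel_mul (c := c) hh hX y
  simp_rw [← integral_const_mul]
  rw [integral_integral_swap hint, ← integral_add]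
  · congr 1; ext ω
    rw [besselKernel_eq_indicator_add_integral (hX1 ω), mul_add, ← integral_const_mul]
    congr 2; ext t; ring
  · refine hh.mul_bdd (c := 1) (Measurable.aestronglyMeasurable (Measurable.ite
      (measurableSet_lt hX measurable_const) measurable_const measurable_const))
      (Eventually.of_forall fun ω => ?_)
    split_ifs <;> simp
  · exact hint.integral_prod_right

theorem abs_integral_mul_indicator_le (hh : Integrable h m) (t : ℝ) :
    |∫ ω, h ω * (if X ω < t then 1 else 0) ∂m| ≤ ∫ ω, ‖h ω‖ ∂m := by
  rw [← Real.norm_eq_abs]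
  refine norm_integral_le_of_norm_le hh.norm (Eventually.of_forall fun ω => ?_)
  split_ifs <;> simp

theorem ae_integral_mul_indicator_eq_zero [SFinite m] (hh : Integrable h m) (hX : Measurable X)
    (hX1 : ∀ ω, 1 ≤ X ω) (hc : 0 < c)
    (h0 : ∀ p : ℝ, 0 < p → ∫ ω, h ω * Real.exp (-(p * X ω) + c / (p * X ω)) ∂m = 0) :
    ∀ᵐ t, ∫ ω, h ω * (if X ω < t then 1 else 0) ∂m = 0 := by
  set H : ℝ → ℝ := fun t => ∫ ω, h ω * (if X ω < t then 1 else 0) ∂m with hHdef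
  have hmeas : AEStronglyMeasurable H volume := by
    have hm : Measurable fun q : ℝ × Ω => (if X q.2 < q.1 then (1 : ℝ) else 0) :=
      Measurable.ite (measurableSet_lt (hX.comp measurable_snd) measurable_fst)
        measurable_const measurable_const
    exact (hh.aestronglyMeasurable.comp_snd.mul hm.aestronglyMeasurable).integral_prod_right'
  have hbound : ∀ t, |H t| ≤ ∫ ω, ‖h ω‖ ∂m := abs_integral_mul_indicator_le hh
  have hlow : ∀ t, t ≤ 1 → H t = 0 := fun t ht => by
    have : ∀ ω, ¬ X ω < t := fun ω => not_lt.2 (ht.trans (hX1 ω))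
    simp [hHdef, this]
  have hY : ∀ N : ℕ, ∀ᵐ y, y ∈ Ioc (1 : ℝ) N → H y = 0 := by
    intro N
    obtain ⟨M, hM, hMb⟩ := exists_bound_volterraKernel c N
    refine ae_eq_zero_of_abs_le_mul_integral hM hbound ?_
    filter_upwards [ae_integral_besselKernel_eq_zero hh hX hX1 hc h0] with y hy hyN
    have h1 := hy (by linarith [hyN.1])
    rw [integral_besselKernel_eq hh hX hX1 y] at h1
    have h2 : H y = -∫ t in Ioc 1 y, volterraKernel c y t * H t := eq_neg_of_add_eq_zero_left h1
    have hHi : IntegrableOn H (Ioc 1 y) :=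
      Integrable.of_bound hmeas.restrict _ (Eventually.of_forall hbound)
    rw [h2, abs_neg, ← integral_const_mul, ← Real.norm_eq_abs]
    refine norm_integral_le_of_norm_le (hHi.norm.const_mul M)
      ((ae_restrict_iff' measurableSet_Ioc).2 (Eventually.of_forall fun t ht => ?_))
    rw [norm_mul]
    refine mul_le_mul_of_nonneg_right ?_ (norm_nonneg _)
    exact hMb y ⟨hyN.1.le, hyN.2⟩ t ⟨ht.1.le, ht.2.trans hyN.2⟩
  filter_upwards [ae_all_iff.2 hY] with y hy
  rcases le_or_gt y 1 with h1 | h1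
  · exact hlow y h1
  · obtain ⟨N, hN⟩ := exists_nat_ge y
    exact hy N ⟨h1, hN⟩

/-- If `∫ h e^{-pX + c/(pX)} = 0` for all `p > 0`, then the image under `X` of the measure `h · m`
is zero. -/
theorem setIntegral_preimage_eq_zero [SFinite m] (hh : Integrable h m) (hX : Measurable X)
    (hX1 : ∀ ω, 1 ≤ X ω) (hc : 0 < c)
    (h0 : ∀ p : ℝ, 0 < p → ∫ ω, h ω * Real.exp (-(p * X ω) + c / (p * X ω)) ∂m = 0)
    {B : Set ℝ} (hB : MeasurableSet B) : ∫ ω in X ⁻¹' B, h ω ∂m = 0 := by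
  have hae : ∀ᵐ t, ∫ ω in X ⁻¹' Iio t, h ω ∂m = 0 := by
    filter_upwards [ae_integral_mul_indicator_eq_zero hh hX hX1 hc h0] with t ht
    rw [← ht, ← integral_indicator (hX measurableSet_Iio)]
    congr 1; ext ω
    by_cases hω : X ω < t <;> simp [hω]
  have hdense := Measure.dense_of_ae hae
  have hmono : ∀ u : ℕ → ℝ, Monotone u → (∀ n, ∫ ω in X ⁻¹' Iio (u n), h ω ∂m = 0) →
      ∫ ω in ⋃ n, X ⁻¹' Iio (u n), h ω ∂m = 0 := by
    intro u hu hu0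
    have := tendsto_setIntegral_of_monotone (μ := m) (f := h)
      (s := fun n => X ⁻¹' Iio (u n)) (fun n => hX measurableSet_Iio)
      (fun i j hij => preimage_mono (Iio_subset_Iio (hu hij))) hh.integrableOn
    simp_rw [hu0] at this
    exact (tendsto_const_nhds_iff.1 this).symm
  have hIio : ∀ a, ∫ ω in X ⁻¹' Iio a, h ω ∂m = 0 := by
    intro a
    -- The distribution function is left-continuous and vanishes on a dense set.
    obtain ⟨u, humono, hu, hlim⟩ := hdense.exists_seq_strictMono_tendsto a
    have : X ⁻¹' Iio a = ⋃ n, X ⁻¹' Iio (u n) := by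
      ext ω
      simp only [mem_preimage, mem_Iio, mem_iUnion]
      exact ⟨fun hω => (hlim.eventually (lt_mem_nhds hω)).exists,
        fun ⟨n, hn⟩ => hn.trans (hu n).1⟩
    rw [this]
    exact hmono u humono.monotone fun n => (hu n).2
  have huniv : ∫ ω, h ω ∂m = 0 := by
    have : (⋃ n : ℕ, X ⁻¹' Iio (n : ℝ)) = univ := by
      ext ω
      simpa using exists_nat_gt (X ω)
    rw [← setIntegral_univ, ← this]
    exact hmono _ Nat.mono_cast fun n => hIio n
  induction B, hB using MeasurableSpace.induction_on_inter
    (borel_eq_generateFrom_Iio ℝ ▸ BorelSpace.measurable_eq) isPiSystem_Iio with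
  | empty => simp
  | basic t ht => obtain ⟨a, rfl⟩ := ht; exact hIio a
  | compl t ht ih =>
    rw [preimage_compl, setIntegral_compl (hX ht) hh, ih, huniv, sub_zero]
  | iUnion f hd hf ih =>
    rw [preimage_iUnion, integral_iUnion (fun n => hX (hf n))
      (fun i j hij => (hd hij).preimage X) hh.integrableOn]
    simp [ih]

end distribution

end Distribution

/-! ### Complex measures and the hyperbola -/

section ComplexMeasures

open Set Filter
open scoped Real

/-- Every complex measure has an integrable density with respect to a finite measure, namely the sum
of the total variations of its real and imaginary parts. -/
theorem exists_eq_withDensityᵥ {Ω : Type*} [MeasurableSpace Ω] (μ : ComplexMeasure Ω) :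
    ∃ (m : Measure Ω) (h : Ω → ℂ), IsFiniteMeasure m ∧ Integrable h m ∧ m.withDensityᵥ h = μ := by
  set a : SignedMeasure Ω := ComplexMeasure.re μ with ha
  set b : SignedMeasure Ω := ComplexMeasure.im μ with hb
  set m : Measure Ω := a.totalVariation + b.totalVariation with hm
  have hac : ∀ s : SignedMeasure Ω, s.totalVariation ≤ m →
      m.withDensityᵥ (s.rnDeriv m) = s := fun s hs => by
    refine s.withDensityᵥ_rnDeriv_eq m (VectorMeasure.AbsolutelyContinuous.mk fun A hA hA0 => ?_)
    rw [Measure.toENNRealVectorMeasure_apply_measurable hA] at hA0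
    exact s.null_of_totalVariation_zero (le_antisymm (hA0 ▸ hs A) bot_le)
  refine ⟨m, μ.rnDeriv m, inferInstance, μ.integrable_rnDeriv m, ?_⟩
  have h1 := hac a (Measure.le_add_right le_rfl)
  have h2 := hac b (Measure.le_add_left le_rfl)
  have hi := μ.integrable_rnDeriv m
  ext A hA
  rw [withDensityᵥ_apply hi hA]
  apply Complex.ext
  · have : (μ A).re = a A := rfl
    rw [this, ← h1, withDensityᵥ_apply (a.integrable_rnDeriv m) hA]
    exact (Complex.reCLM.integral_comp_comm hi.integrableOn).symm
  · have : (μ A).im = b A := rfl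
    rw [this, ← h2, withDensityᵥ_apply (b.integrable_rnDeriv m) hA]
    exact (Complex.imCLM.integral_comp_comm hi.integrableOn).symm

/-- For bounded integrands, integration against the complex measure with density `h` is Bochner
integration against `h`. -/
theorem integral_withDensityᵥ_eq_integral_mul {Ω : Type*} [MeasurableSpace Ω] {m : Measure Ω}
    {h : Ω → ℂ} (hh : Integrable h m) {f : Ω → ℂ} (hf : StronglyMeasurable f) {C : ℝ}
    (hC : ∀ ω, ‖f ω‖ ≤ C) :
    VectorMeasure.integral (m.withDensityᵥ h) f (ContinuousLinearMap.mul ℝ ℂ) =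
      ∫ ω, f ω * h ω ∂m := by
  have hfin : IsFiniteMeasure (m.withDensityᵥ h).variation := by
    rw [Measure.variation_withDensityᵥ hh]
    exact isFiniteMeasure_withDensity hh.2.ne
  have hmul : ∀ g : SimpleFunc Ω ℂ, Integrable (fun ω => g ω * h ω) m := fun g => by
    obtain ⟨D, hD⟩ := g.exists_forall_norm_le
    exact hh.bdd_mul g.stronglyMeasurable.aestronglyMeasurable (Eventually.of_forall hD)
  have hsimple : ∀ g : SimpleFunc Ω ℂ,
      VectorMeasure.integral (m.withDensityᵥ h) g (ContinuousLinearMap.mul ℝ ℂ) =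
        ∫ ω, g ω * h ω ∂m := by
    intro g
    induction g using SimpleFunc.induction with
    | const c hs =>
      rename_i s
      have : ∀ ω, (s.indicator (fun _ => c) ω) * h ω = s.indicator (fun ω => c * h ω) ω := by
        intro ω; by_cases hω : ω ∈ s <;> simp [hω]
      have hcoe : ⇑(SimpleFunc.piecewise s hs (SimpleFunc.const Ω c) (SimpleFunc.const Ω 0)) =
          s.indicator fun _ => c := by
        ext ω; by_cases hω : ω ∈ s <;> simp [hω]
      rw [hcoe, VectorMeasure.integral_indicator_const _ hs]
      simp_rw [this]
      rw [integral_indicator hs, integral_const_mul, withDensityᵥ_apply hh hs]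
      rfl
    | add hd ihf ihg =>
      rename_i f g
      rw [SimpleFunc.coe_add, VectorMeasure.integral_add f.integrable_of_isFiniteMeasure
        g.integrable_of_isFiniteMeasure, ihf, ihg, ← integral_add (hmul f) (hmul g)]
      simp [add_mul]
  have hC0 : ∀ ω, 0 ≤ C := fun ω => (norm_nonneg _).trans (hC ω)
  have hlim : ∀ ω, Tendsto (fun n => hf.approxBounded C n ω) atTop (nhds (f ω)) := fun ω =>
    hf.tendsto_approxBounded_of_norm_le (hC ω)
  have hL : Tendsto (fun n => VectorMeasure.integral (m.withDensityᵥ h)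
      (fun ω => hf.approxBounded C n ω) (ContinuousLinearMap.mul ℝ ℂ)) atTop
      (nhds (VectorMeasure.integral (m.withDensityᵥ h) f (ContinuousLinearMap.mul ℝ ℂ))) :=
    VectorMeasure.tendsto_integral_of_dominated_convergence (fun _ => C)
    (fun n => (hf.approxBounded C n).stronglyMeasurable.aestronglyMeasurable)
    (integrable_const C)
    (fun n => Eventually.of_forall fun ω => hf.norm_approxBounded_le (hC0 ω) n ω)
    (Eventually.of_forall hlim)
  have hR := tendsto_integral_of_dominated_convergence
    (μ := m) (F := fun n ω => hf.approxBounded C n ω * h ω) (f := fun ω => f ω * h ω)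
    (fun ω => C * ‖h ω‖)
    (fun n => (hmul _).aestronglyMeasurable)
    (hh.norm.const_mul C)
    (fun n => Eventually.of_forall fun ω => by
      rw [norm_mul]
      gcongr
      exact hf.norm_approxBounded_le (hC0 ω) n ω)
    (Eventually.of_forall fun ω => (hlim ω).mul_const _)
  simp_rw [hsimple] at hL
  exact tendsto_nhds_unique hL hR

/-- If the transform of `h · m` vanishes on the real line, then the image under `X` of `h · m` is
zero. On the line `Im z = π / 2` the kernel is real, which reduces the complex density `h` to its
real and imaginary parts. -/
theorem setIntegral_preimage_eq_zero_of_phase {Ω : Type*} [MeasurableSpace Ω] {m : Measure Ω}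
    [SFinite m] {h : Ω → ℂ} {X : Ω → ℝ} (hh : Integrable h m) (hX : Measurable X)
    (hX1 : ∀ ω, 1 ≤ X ω)
    (h0 : ∀ s : ℝ, ∫ ω, h ω * Complex.exp (phase s (X ω)) ∂m = 0)
    {B : Set ℝ} (hB : MeasurableSet B) : ∫ ω in X ⁻¹' B, h ω ∂m = 0 := by
  have hπ := Real.pi_pos
  have hreal : ∀ p : ℝ, 0 < p →
      Integrable (fun ω => h ω * (Real.exp (-(p * X ω) + π ^ 2 / 4 / (p * X ω)) : ℝ)) m ∧
      ∫ ω, h ω * (Real.exp (-(p * X ω) + π ^ 2 / 4 / (p * X ω)) : ℝ) ∂m = 0 := by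
    intro p hp
    -- The choice of `s` gives `(π / 2) e^{-s} = p`.
    set s : ℝ := Real.log (π / (2 * p)) with hs
    have hes : Real.exp s = π / (2 * p) := Real.exp_log (by positivity)
    have hph : ∀ ω, Complex.exp (phase (s + π / 2 * Complex.I) (X ω)) =
        (Real.exp (-(p * X ω) + π ^ 2 / 4 / (p * X ω)) : ℝ) := by
      intro ω
      have hx : (X ω : ℂ) ≠ 0 := by
        exact_mod_cast (zero_lt_one.trans_le (hX1 ω)).ne'
      have hp' : (p : ℂ) ≠ 0 := by exact_mod_cast hp.ne'
      have hπ' : (π : ℂ) ≠ 0 := by exact_mod_cast hπ.ne'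
      rw [Complex.ofReal_exp]
      congr 1
      rw [phase, neg_add, Complex.exp_add, Complex.exp_add, Complex.exp_neg (s : ℂ),
        Complex.exp_neg (_ * Complex.I), Complex.exp_pi_div_two_mul_I, Complex.inv_I,
        ← Complex.ofReal_exp, hes]
      push_cast
      field_simp
      ring_nf
      simp only [Complex.I_sq]
      ring
    simp_rw [← hph]
    refine ⟨hh.mul_bdd (c := Real.exp (π / 2 * Real.exp s))
      ((measurable_exp_phase _).comp hX).aestronglyMeasurable
      (Eventually.of_forall fun ω => ?_), integral_exp_phase_eq_zero hh hX hX1 h0 s⟩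
    refine (norm_exp_phase_le (hX1 ω) ?_ ?_).trans_eq ?_
    · simp; positivity
    · simp; linarith
    · simp
  apply Complex.ext
  · have := setIntegral_preimage_eq_zero (c := π ^ 2 / 4) hh.re hX hX1 (by positivity)
      (fun p hp => by
        have h1 := Complex.reCLM.integral_comp_comm (hreal p hp).1
        rw [(hreal p hp).2, map_zero] at h1
        simp only [Complex.reCLM_apply, Complex.re_mul_ofReal] at h1
        exact h1) hB
    exact (Complex.reCLM.integral_comp_comm hh.integrableOn).symm.trans this
  · have := setIntegral_preimage_eq_zero (c := π ^ 2 / 4) hh.im hX hX1 (by positivity)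
      (fun p hp => by
        have h1 := Complex.imCLM.integral_comp_comm (hreal p hp).1
        rw [(hreal p hp).2, map_zero] at h1
        simp only [Complex.imCLM_apply, Complex.im_mul_ofReal] at h1
        exact h1) hB
    exact (Complex.imCLM.integral_comp_comm hh.integrableOn).symm.trans this

theorem measurableSet_hyperbola :
    MeasurableSet {p : Plane | ∃ t : ℝ, 0 ≤ t ∧ p = !₂[Real.cosh t, Real.sinh t]} := by
  have : {p : Plane | ∃ t : ℝ, 0 ≤ t ∧ p = !₂[Real.cosh t, Real.sinh t]} =
      {p : Plane | 0 ≤ p 1} ∩ {p : Plane | p 0 = √(1 + p 1 ^ 2)} := by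
    ext p
    constructor
    · rintro ⟨t, ht, rfl⟩
      refine ⟨by simpa using ht, ?_⟩
      have : 1 + Real.sinh t ^ 2 = Real.cosh t ^ 2 := by rw [Real.cosh_sq]; ring
      simp [this, Real.sqrt_sq (Real.cosh_pos t).le]
    · rintro ⟨h1, h2⟩
      refine ⟨Real.arsinh (p 1), Real.arsinh_nonneg_iff.2 h1, ?_⟩
      ext i
      fin_cases i
      · simpa [Real.cosh_arsinh] using h2
      · simp
  rw [this]
  exact (measurableSet_le measurable_const (by fun_prop)).inter
    (measurableSet_eq_fun (by fun_prop) (by fun_prop))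

end ComplexMeasures

end HeisenbergUniqueness

open HeisenbergUniqueness in
theorem theorem2p10 :
    HeisenbergUniqueness.IsHUP
      {p : HeisenbergUniqueness.Plane | ∃ t : ℝ, 0 ≤ t ∧ p = !₂[Real.cosh t, Real.sinh t]}
      {p : HeisenbergUniqueness.Plane | ∃ s : ℝ, p = !₂[Real.cosh s, -Real.sinh s]} := by
  set Γ : Set Plane := {p : Plane | ∃ t : ℝ, 0 ≤ t ∧ p = !₂[Real.cosh t, Real.sinh t]} with hΓ
  rintro μ ⟨hcar, -⟩ hμ
  have hΓm : MeasurableSet Γ := measurableSet_hyperbola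
  obtain ⟨m, h, hm, hh, rfl⟩ := exists_eq_withDensityᵥ μ
  have hoff : ∀ᵐ z ∂m, z ∉ Γ → h z = 0 := by
    have := hh.integrableOn.ae_eq_zero_of_forall_setIntegral_eq_zero (μ := m.restrict Γᶜ)
      fun A hA _ => by
        rw [Measure.restrict_restrict hA, ← withDensityᵥ_apply hh (hA.inter hΓm.compl)]
        exact hcar _ (hA.inter hΓm.compl)
          (Set.disjoint_left.2 fun z hz hzΓ => hz.2 hzΓ)
    exact (ae_restrict_iff' hΓm.compl).1 this
  -- The coordinate `e^t` on `Γ`; the maximum with `1` keeps it at least `1` off `Γ` too.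
  set X : Plane → ℝ := fun z => max 1 (z 0 + z 1) with hXdef
  have hX : Measurable X := by fun_prop
  have hXΓ : ∀ t : ℝ, 0 ≤ t → X !₂[Real.cosh t, Real.sinh t] = Real.exp t := fun t ht => by
    simp [hXdef, Real.cosh_add_sinh, ht]
  have hphase : ∀ s : ℝ, ∫ z, h z * Complex.exp (phase s (X z)) ∂m = 0 := by
    intro s
    have h1 := hμ _ ⟨s, rfl⟩
    rw [fourierTransform, integral_withDensityᵥ_eq_integral_mul hh (C := 1)
      (Continuous.stronglyMeasurable (by fun_prop))
      (fun z => by rw [Complex.norm_exp]; simp)] at h1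
    rw [← h1]
    refine integral_congr_ae ?_
    filter_upwards [hoff] with z hz
    by_cases hzΓ : z ∈ Γ
    · obtain ⟨t, ht, rfl⟩ := hzΓ
      rw [mul_comm]
      congr 2
      rw [hXΓ t ht, phase]
      have h2 : Real.cosh t * Real.cosh s + Real.sinh t * -Real.sinh s = Real.cosh (t - s) := by
        rw [Real.cosh_sub]; ring
      simp only [Matrix.cons_val_zero, Matrix.cons_val_one, h2]
      rw [Real.cosh_eq, Real.exp_neg, Real.exp_sub]
      push_cast
      rw [Complex.exp_neg]
      have := Complex.exp_ne_zero t
      have := Complex.exp_ne_zero s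
      field_simp
    · simp [hz hzΓ]
  -- The inverse of `X` on `Γ`.
  set σ : ℝ → Plane := fun x => !₂[(x + x⁻¹) / 2, (x - x⁻¹) / 2] with hσdef
  have hσ : Measurable σ := by
    rw [hσdef]
    refine (WithLp.measurable_toLp 2 _).comp (measurable_pi_iff.2 fun i => ?_)
    fin_cases i
    · simp; fun_prop
    · simp; fun_prop
  have hσΓ : ∀ z ∈ Γ, σ (X z) = z := by
    rintro _ ⟨t, ht, rfl⟩
    rw [hXΓ t ht, hσdef]
    ext i
    fin_cases i
    · simp [Real.cosh_eq, Real.exp_neg]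
    · simp [Real.sinh_eq, Real.exp_neg]
  ext A hA
  rw [withDensityᵥ_apply hh hA, zero_apply,
    ← setIntegral_preimage_eq_zero_of_phase hh hX (fun z => le_max_left _ _) hphase (hσ hA),
    ← integral_indicator hA, ← integral_indicator (hX (hσ hA))]
  refine integral_congr_ae ?_
  filter_upwards [hoff] with z hz
  by_cases hzΓ : z ∈ Γ
  · have hiff : z ∈ X ⁻¹' (σ ⁻¹' A) ↔ z ∈ A := by
      change σ (X z) ∈ A ↔ z ∈ A
      rw [hσΓ z hzΓ]
    by_cases hzA : z ∈ A
    · rw [Set.indicator_of_mem hzA, Set.indicator_of_mem (hiff.2 hzA)]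
    · rw [Set.indicator_of_notMem hzA, Set.indicator_of_notMem (fun h' => hzA (hiff.1 h'))]
  · simp [Set.indicator, hz hzΓ]
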